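/- Definitions. The dartboard is the unit square $[0,1]^2$, partitioned into a finite set $\mathcal C$ of measurable cells; the size $p_i$ of a cell is its area. A dartboard sketch has a state space of subsets of $\mathcal C$ (the set of occupied cells), an initial state, and a transition function giving the next state when a dart hits a cell, such that (R1) a cell that contains a dart is occupied, (R2) a dart hitting an occupied cell does not change the state, and (R3) an occupied cell never becomes free. The sketch is linearizable if there are an enumeration $c_0,\dots,c_{|\mathcal C|-1}$ of the cells and a function $\phi:\{0,1\}^*\to\{0,1\}$, monotone on words of each length, such that after every finite sequence of darts $Y_i=Z_i\vee\phi(Y_0,\dots,Y_{i-1})$ for all $i$, where $Z_i$ indicates that $c_i$ has been hit by a dart and $Y_i$ that $c_i$ is occupied. At time $\lambda>0$, $\mathrm{Poisson}(\lambda)$ independent uniform darts have been thrown; $\mathbf Y_{[\lambda]}=(Y_0,\dots,Y_{|\mathcal C|-1})$ is the resulting random state and $f_\lambda$ its probability mass function. Let $H(\mathbf Y_{[\lambda]})=\mathbb E[-\log_2 f_\lambda(\mathbf Y_{[\lambda]})]$ be its Shannon entropy and $I_{\mathbf Y}(\lambda)=\mathbb E\big[\big(\tfrac{\partial}{\partial\lambda}f_\lambda(\mathbf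 Y_{[\lambda]})/f_\lambda(\mathbf Y_{[\lambda]})\big)^2\big]$ its Fisher information. Put $h(x)=-x\ln x-(1-x)\ln(1-x)$ and $$H_0=\frac1{\ln 2}\int_{-\infty}^{\infty}h\big(e^{-e^w}\big)\,dw,\qquad I_0=\int_{-\infty}^\infty\frac{e^{2w}}{e^{e^w}-1}\,dw,$$ $$\rho(d)=1-\max\big(8d^{-1/4},5e^{-d/2}\big),\qquad D(d)=1+\frac{344+4\sqrt d}{d}\cdot\frac{H_0}{I_0}\,\rho(d).$$ Theorem. Let $a<b$ be reals with $d=b-a>1$ and $D(d)>0$ (which holds for all $d\ge 4096$), and let $\tilde H,\tilde I>0$. If a linearizable dartboard sketch satisfies - $H(\mathbf Y_{[\lambda]})\le\tilde H$ for all $\lambda>0$, and - $\lambda^2 I_{\mathbf Y}(\lambda)\ge\tilde I$ for all $\lambda\in[e^a,e^b]$, then $$\frac{\tilde H}{\tilde I}\;\ge\;\frac{H_0}{I_0}\cdot\frac{\rho(d)}{D(d)}.$$ Moreover, the right-hand side equals $(1-\varepsilon(d))\,H_0/I_0$ for a function $\varepsilon$ with $\varepsilon(d)\to0$ as $d\to\infty$.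 -/

import Mathlib

open scoped BigOperators

noncomputable section

/-- The unit square `[0,1]²`, with Lebesgue measure (a probability measure) as `volume`. -/
abbrev Dartboard : Type := unitInterval × unitInterval

/-- A dartboard sketch with set of cells `C`.  The partition of the unit square into cells is given
by the map `cellOf` sending a point to the cell that contains it.  A state is identified with its
set of occupied cells, and `step σ c` is the state reached from `σ` when a dart hits cell `c`. -/
structure DartboardSketch (C : Type*) where
  /-- the cell containing a given point of the dartboard -/
  cellOf : Dartboard → C
  measurableSet_cell : ∀ c, MeasurableSet (cellOf ⁻¹' {c})
  /-- the state space -/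
  states : Set (Finset C)
  /-- the state before any dart is thrown -/
  init : Finset C
  init_mem : init ∈ states
  /-- the transition function -/
  step : Finset C → C → Finset C
  step_mem : ∀ σ ∈ states, ∀ c, step σ c ∈ states
  /-- (R1) every cell containing a dart is occupied -/
  mem_step : ∀ σ ∈ states, ∀ c, c ∈ step σ c
  /-- (R2) a dart hitting an occupied cell does not change the state -/
  step_of_mem : ∀ σ ∈ states, ∀ c ∈ σ, step σ c = σ
  /-- (R3) an occupied cell never becomes free -/
  subset_step : ∀ σ ∈ states, ∀ c, σ ⊆ step σ c

namespace DartboardSketch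

variable {C : Type*}

/-- The state reached after throwing the darts `x 0, …, x (k-1)` in this order. -/
def stateAfter (S : DartboardSketch C) {k : ℕ} (x : Fin k → Dartboard) : Finset C :=
  (List.ofFn fun j => S.cellOf (x j)).foldl S.step S.init

open scoped Classical in
/-- `S` is linearizable: there are an enumeration `c 0, c 1, …, c (|C|-1)` of the cells and a
monotone `φ : {0,1}* → {0,1}` (given by its restrictions `φ i` to words of length `i`) such that
always `Y i = Z i ∨ φ (Y 0, …, Y (i-1))`, where `Z i` says whether `c i` has been hit by a dart
and `Y i` whether `c i` is occupied. -/
def IsLinearizable [Fintype C] (S : DartboardSketch C) : Prop :=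
  ∃ (c : Fin (Fintype.card C) ≃ C) (φ : (i : ℕ) → (Fin i → Bool) → Bool),
    (∀ i, Monotone (φ i)) ∧
    ∀ (k : ℕ) (x : Fin k → Dartboard) (i : Fin (Fintype.card C)),
      c i ∈ S.stateAfter x ↔
        (∃ j, S.cellOf (x j) = c i) ∨
          φ i (fun j => decide (c (j.castLE i.isLt.le) ∈ S.stateAfter x)) = true

/-- The probability that the Poissonized sketch is in state `σ` at time (cardinality) `t`, when
`Poisson(t)` independent uniform darts have been thrown. -/
def stateProb (S : DartboardSketch C) (t : ℝ) (σ : Finset C) : ℝ :=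
  ∑' k : ℕ, Real.exp (-t) * t ^ k / (k.factorial : ℝ) *
    (MeasureTheory.volume {x : Fin k → Dartboard | S.stateAfter x = σ}).toReal

end DartboardSketch

/-- Shannon entropy (in bits) `𝔼[-log₂ f(X)]` of a random variable `X` with mass function `f`. -/
def shannonEntropy {α : Type*} [Fintype α] (f : α → ℝ) : ℝ :=
  ∑ x, f x * -Real.logb 2 (f x)

/-- Fisher information `𝔼[((∂/∂t) f_t(X) / f_t(X))²]` at the parameter `t` of a random variable `X`
with mass function `f t`. -/
def fisherInformation {α : Type*} [Fintype α] (f : ℝ → α → ℝ) (t : ℝ) : ℝ :=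
  ∑ x, f t x * (deriv (fun s => f s x) t / f t x) ^ 2

/-- Entropy in nats of a Bernoulli variable. -/
def hNat (x : ℝ) : ℝ := -x * Real.log x - (1 - x) * Real.log (1 - x)

/-- The constant `H₀`. -/
def H₀ : ℝ := 1 / Real.log 2 * ∫ w : ℝ, hNat (Real.exp (-Real.exp w))

/-- The constant `I₀`, the integral over `w ∈ ℝ` of `g(e^w)` with `g(x) = x² / (e^x - 1)`. -/
def I₀ : ℝ := ∫ w : ℝ, Real.exp w ^ 2 / (Real.exp (Real.exp w) - 1)

/-- `1 - max(8 d^{-1/4}, 5 e^{-d/2})`. -/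
def lossFactor (d : ℝ) : ℝ :=
  1 - max (8 * d ^ (-(1 / 4) : ℝ)) (5 * Real.exp (-d / 2))

/-- The denominator `1 + ((344 + 4√d)/d) (H₀/I₀) (1 - max(8 d^{-1/4}, 5 e^{-d/2}))`. -/
def lossDenominator (d : ℝ) : ℝ :=
  1 + (344 + 4 * Real.sqrt d) / d * (H₀ / I₀) * lossFactor d

end

open MeasureTheory Set Filter Topology

/-!
By Poissonization the cells are hit independently, and the state is determined by which cells are
hit. Revealing the occupied bits in the order of the linearization, the chain rules for entropy and
for Fisher information express both quantities at time `t` as sums over the cells `i` of the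
probability that no earlier cell forces `i` to be occupied, times the entropy or the Fisher
information of the single bit recording a miss of `i`, an event of probability `e ^ (-t p i)`.

On the logarithmic time axis `t = e ^ x` the contributions of a single cell are translates by
`log (p i)` of two fixed densities with integrals `H₀` and `I₀`, and by monotonicity of `φ` the
weights decrease with time. The ratio of the entropy density to the Fisher density is decreasing,
so, up to an exponentially small loss, a decreasing weight gives at least the ratio `H₀ / I₀` as
soon as the entropy is integrated over `[a - D, b]` and the Fisher information over `[a, b]`.
Summing over the cells compares `(b - a + D) * Hmax` with `(b - a) * Imin`, and `D` of order
`(b - a) ^ (3 / 4)` balances the two losses.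
-/

lemma hNat_eq_binEntropy : hNat = Real.binEntropy := by
  ext x
  simp only [hNat, Real.binEntropy, Real.log_inv]
  ring

lemma exp_neg_exp_lt_one (w : ℝ) : Real.exp (-Real.exp w) < 1 :=
  Real.exp_lt_one_iff.2 (neg_neg_of_pos (Real.exp_pos w))

lemma exp_exp_sub_one_pos (w : ℝ) : 0 < Real.exp (Real.exp w) - 1 :=
  sub_pos.2 (Real.one_lt_exp_iff.2 (Real.exp_pos w))

/-- The integrand of `H₀`: the entropy, in bits, of the indicator that a cell of area `e^w` is
missed at time `1`. -/
noncomputable def entropyDensity (w : ℝ) : ℝ := hNat (Real.exp (-Real.exp w)) / Real.log 2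

/-- The integrand of `I₀`: the Fisher information at time `1` of the indicator that a cell of area
`e^w` is missed. -/
noncomputable def fisherDensity (w : ℝ) : ℝ := Real.exp w ^ 2 / (Real.exp (Real.exp w) - 1)

lemma H₀_eq_integral : H₀ = ∫ w, entropyDensity w := by
  simp only [H₀, entropyDensity, integral_div]
  ring

lemma I₀_eq_integral : I₀ = ∫ w, fisherDensity w := rfl

lemma entropyDensity_eq (w : ℝ) :
    entropyDensity w = (Real.exp w * Real.exp (-Real.exp w) +
      (1 - Real.exp (-Real.exp w)) * -Real.log (1 - Real.exp (-Real.exp w))) / Real.log 2 := by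
  simp only [entropyDensity, hNat, Real.log_exp]
  ring

lemma fisherDensity_eq (w : ℝ) :
    fisherDensity w = Real.exp w ^ 2 * Real.exp (-Real.exp w) / (1 - Real.exp (-Real.exp w)) := by
  have h := (exp_exp_sub_one_pos w).ne'
  rw [fisherDensity, Real.exp_neg]
  field_simp

lemma entropyDensity_pos (w : ℝ) : 0 < entropyDensity w := by
  rw [entropyDensity, hNat_eq_binEntropy]
  exact div_pos (Real.binEntropy_pos (Real.exp_pos _) (exp_neg_exp_lt_one w))
    (Real.log_pos one_lt_two)

lemma fisherDensity_pos (w : ℝ) : 0 < fisherDensity w :=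
  div_pos (by positivity) (exp_exp_sub_one_pos w)

lemma continuous_entropyDensity : Continuous entropyDensity := by
  unfold entropyDensity
  rw [hNat_eq_binEntropy]
  fun_prop

lemma continuous_fisherDensity : Continuous fisherDensity := by
  unfold fisherDensity
  exact Continuous.div (by fun_prop) (by fun_prop) fun w => (exp_exp_sub_one_pos w).ne'

lemma one_sub_exp_neg_div_antitoneOn : AntitoneOn (fun x => (1 - Real.exp (-x)) / x) (Ioi 0) := by
  intro x hx y hy hxy
  have h := convexOn_exp.secant_mono (mem_univ 0) (mem_univ (-y)) (mem_univ (-x))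
    (neg_ne_zero.2 (ne_of_gt hy)) (neg_ne_zero.2 (ne_of_gt hx)) (neg_le_neg hxy)
  rw [Real.exp_zero, sub_zero, sub_zero, ← neg_sub, ← neg_sub 1 (Real.exp (-x)), neg_div_neg_eq,
    neg_div_neg_eq] at h
  exact h

lemma neg_log_one_sub_div_monotoneOn :
    MonotoneOn (fun q => -Real.log (1 - q) / q) (Ioo 0 1) := by
  intro p hp q hq hpq
  have h := strictConcaveOn_log_Ioi.concaveOn.neg.secant_mono (mem_Ioi.2 one_pos)
    (mem_Ioi.2 (sub_pos.2 hq.2)) (mem_Ioi.2 (sub_pos.2 hp.2)) (by simpa using hq.1.ne')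
    (by simpa using hp.1.ne') (sub_le_sub_left hpq 1)
  simp only [Pi.neg_apply, Real.log_one, neg_zero, sub_zero, sub_sub_cancel_left, div_neg] at h
  exact neg_le_neg_iff.1 h

/-- The monotonicity behind the theorem: small cells have more entropy per unit of Fisher
information than large ones. -/
lemma entropyDensity_div_fisherDensity_antitone :
    Antitone fun w => entropyDensity w / fisherDensity w := by
  have ratio_eq : ∀ w, entropyDensity w / fisherDensity w =
      ((1 - Real.exp (-Real.exp w)) / Real.exp w + ((1 - Real.exp (-Real.exp w)) / Real.exp w) ^ 2 *
        (-Real.log (1 - Real.exp (-Real.exp w)) / Real.exp (-Real.exp w))) / Real.log 2 := by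
    intro w
    have h := (sub_pos.2 (exp_neg_exp_lt_one w)).ne'
    rw [entropyDensity_eq, fisherDensity_eq]
    field_simp
  intro v w hvw
  have hexp := Real.exp_le_exp.2 hvw
  have mem : ∀ u, Real.exp (-Real.exp u) ∈ Ioo (0 : ℝ) 1 := fun u =>
    ⟨Real.exp_pos _, exp_neg_exp_lt_one u⟩
  have hlog : 0 ≤ -Real.log (1 - Real.exp (-Real.exp w)) / Real.exp (-Real.exp w) :=
    div_nonneg (neg_nonneg.2 (Real.log_nonpos (sub_nonneg.2 (mem w).2.le)
      (sub_le_self 1 (mem w).1.le))) (mem w).1.le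
  have hnonneg : 0 ≤ (1 - Real.exp (-Real.exp w)) / Real.exp w :=
    div_nonneg (sub_nonneg.2 (mem w).2.le) (Real.exp_pos w).le
  simp only [ratio_eq]
  gcongr ?_ / _
  gcongr ?_ + ?_ ^ 2 * ?_
  · exact one_sub_exp_neg_div_antitoneOn (Real.exp_pos v) (Real.exp_pos w) hexp
  · exact one_sub_exp_neg_div_antitoneOn (Real.exp_pos v) (Real.exp_pos w) hexp
  · exact neg_log_one_sub_div_monotoneOn (mem w) (mem v) (Real.exp_le_exp.2 (neg_le_neg hexp))

lemma binEntropy_le_two_mul_sqrt {p : ℝ} (h0 : 0 ≤ p) (h1 : p ≤ 1) :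
    Real.binEntropy p ≤ 2 * √p := by
  have negMulLog_le : Real.negMulLog p ≤ 2 * √p - 2 * p := by
    rcases h0.eq_or_lt with rfl | hp
    · simp
    have hs := Real.sqrt_pos.2 hp
    have h := Real.one_sub_inv_le_log_of_pos hs
    rw [Real.log_sqrt hp.le] at h
    calc Real.negMulLog p = -(2 * p * (Real.log p / 2)) := by rw [Real.negMulLog]; ring
      _ ≤ -(2 * p * (1 - (√p)⁻¹)) := by gcongr
      _ = 2 * √p - 2 * p := by
        have h_div : p * (√p)⁻¹ = √p := Real.div_sqrt
        linear_combination 2 * h_div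
  have negMulLog_one_sub_le : Real.negMulLog (1 - p) ≤ p := by
    rcases h1.eq_or_lt with rfl | hp
    · simp
    have h := Real.one_sub_inv_le_log_of_pos (sub_pos.2 hp)
    calc Real.negMulLog (1 - p) = -((1 - p) * Real.log (1 - p)) := neg_mul _ _
      _ ≤ -((1 - p) * (1 - (1 - p)⁻¹)) := by
        have := sub_nonneg.2 h1
        gcongr
      _ = p := by
        have := (sub_pos.2 hp).ne'
        field_simp
        ring
  rw [Real.binEntropy_eq_negMulLog_add_negMulLog_one_sub]
  linarith

lemma entropyDensity_le (w : ℝ) : entropyDensity w ≤ 3 * Real.exp (-|w| / 2) := by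
  have h0 := (Real.exp_pos (-Real.exp w)).le
  have h1 := (exp_neg_exp_lt_one w).le
  have h_nat : hNat (Real.exp (-Real.exp w)) ≤ 2 * Real.exp (-|w| / 2) := by
    rw [hNat_eq_binEntropy, Real.exp_half]
    rcases le_total 0 w with hw | hw
    · refine (binEntropy_le_two_mul_sqrt h0 h1).trans ?_
      rw [abs_of_nonneg hw]
      gcongr
      linarith [Real.add_one_le_exp w]
    · rw [← Real.binEntropy_one_sub]
      refine (binEntropy_le_two_mul_sqrt (sub_nonneg.2 h1) (sub_le_self 1 h0)).trans ?_
      rw [abs_of_nonpos hw, neg_neg]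
      gcongr
      linarith [Real.add_one_le_exp (-Real.exp w)]
  rw [entropyDensity, div_le_iff₀ (Real.log_pos one_lt_two)]
  nlinarith [Real.log_two_gt_d9, Real.exp_pos (-|w| / 2)]

lemma fisherDensity_le (w : ℝ) : fisherDensity w ≤ 6 * Real.exp (-|w| / 2) := by
  have hy := Real.exp_pos w
  rw [fisherDensity, div_le_iff₀ (exp_exp_sub_one_pos w)]
  rcases le_total 0 w with hw | hw
  · have h_cube : Real.exp w ^ 3 / 6 ≤ Real.exp (Real.exp w) - 1 := by
      have := Real.sum_le_exp_of_nonneg hy.le 4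
      norm_num [Finset.sum_range_succ, Nat.factorial] at this
      nlinarith
    calc Real.exp w ^ 2 = 6 * Real.exp (-w) * (Real.exp w ^ 3 / 6) := by
          rw [Real.exp_neg]
          field_simp
      _ ≤ 6 * Real.exp (-|w| / 2) * (Real.exp (Real.exp w) - 1) := by
          rw [abs_of_nonneg hw]
          gcongr
          linarith
  · calc Real.exp w ^ 2 = 1 * Real.exp w * Real.exp w := by ring
      _ ≤ 6 * Real.exp (-|w| / 2) * (Real.exp (Real.exp w) - 1) := by
          rw [abs_of_nonpos hw, neg_neg]
          gcongr
          · norm_num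
          · linarith
          · linarith [Real.add_one_le_exp (Real.exp w)]

lemma integrable_exp_neg_abs_div_two : Integrable fun w : ℝ => Real.exp (-|w| / 2) := by
  rw [← integrableOn_univ, ← Iic_union_Ioi (a := (0 : ℝ))]
  refine IntegrableOn.union ?_ ?_
  · refine (integrableOn_exp_mul_Iic (one_half_pos (α := ℝ)) 0).congr_fun (fun w hw => ?_)
      measurableSet_Iic
    simp only [abs_of_nonpos (mem_Iic.1 hw), neg_neg, one_div, inv_mul_eq_div]
  · refine (integrableOn_exp_mul_Ioi (neg_neg_of_pos (one_half_pos (α := ℝ))) 0).congr_fun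
      (fun w hw => ?_) measurableSet_Ioi
    simp only [abs_of_pos (mem_Ioi.1 hw), neg_mul, one_div, inv_mul_eq_div, neg_div]

lemma integral_exp_neg_abs_div_two : ∫ w : ℝ, Real.exp (-|w| / 2) = 4 := by
  rw [integral_comp_abs (f := fun w => Real.exp (-w / 2))]
  have h := integral_exp_mul_Ioi (neg_neg_of_pos (one_half_pos (α := ℝ))) 0
  simp only [neg_mul, one_div, inv_mul_eq_div, ← neg_div] at h
  rw [h]
  norm_num

lemma integrable_entropyDensity : Integrable entropyDensity :=
  (integrable_exp_neg_abs_div_two.const_mul 3).mono'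
    continuous_entropyDensity.aestronglyMeasurable
    (.of_forall fun w => (Real.norm_of_nonneg (entropyDensity_pos w).le).trans_le
      (entropyDensity_le w))

lemma integrable_fisherDensity : Integrable fisherDensity :=
  (integrable_exp_neg_abs_div_two.const_mul 6).mono'
    continuous_fisherDensity.aestronglyMeasurable
    (.of_forall fun w => (Real.norm_of_nonneg (fisherDensity_pos w).le).trans_le
      (fisherDensity_le w))

lemma H₀_le : H₀ ≤ 12 := by
  calc H₀ ≤ ∫ w : ℝ, 3 * Real.exp (-|w| / 2) := by
        rw [H₀_eq_integral]
        exact integral_mono integrable_entropyDensity (integrable_exp_neg_abs_div_two.const_mul 3)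
          entropyDensity_le
    _ = 12 := by rw [integral_const_mul, integral_exp_neg_abs_div_two]; norm_num

lemma integral_exp_mul_exp_neg_exp {s : ℝ} (hs : 0 < s) :
    ∫ w : ℝ, Real.exp (s * w) * Real.exp (-Real.exp w) = Real.Gamma s := by
  rw [Real.Gamma_eq_integral hs, ← Real.range_exp, ← image_univ,
    integral_image_eq_integral_abs_deriv_smul MeasurableSet.univ
      (fun w _ => (Real.hasDerivAt_exp w).hasDerivWithinAt) Real.exp_injective.injOn,
    setIntegral_univ]
  refine integral_congr_ae (.of_forall fun w => ?_)
  simp only [abs_of_pos (Real.exp_pos w), smul_eq_mul, ← Real.exp_mul, ← Real.exp_add]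
  ring_nf

lemma exp_mul_exp_neg_exp_le_entropyDensity (w : ℝ) :
    Real.exp w * Real.exp (-Real.exp w) ≤ entropyDensity w := by
  have h_log : 0 ≤ (1 - Real.exp (-Real.exp w)) * -Real.log (1 - Real.exp (-Real.exp w)) :=
    Real.negMulLog_nonneg (sub_nonneg.2 (exp_neg_exp_lt_one w).le)
      (sub_le_self 1 (Real.exp_pos _).le) |>.trans_eq (by rw [Real.negMulLog]; ring)
  have h_nonneg : 0 ≤ Real.exp w * Real.exp (-Real.exp w) := by positivity
  rw [entropyDensity_eq, le_div_iff₀ (Real.log_pos one_lt_two)]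
  nlinarith [Real.log_two_lt_d9]

lemma sq_exp_mul_exp_neg_exp_le_fisherDensity (w : ℝ) :
    Real.exp w ^ 2 * Real.exp (-Real.exp w) ≤ fisherDensity w := by
  rw [fisherDensity_eq]
  exact le_div_self (by positivity) (sub_pos.2 (exp_neg_exp_lt_one w))
    (sub_le_self 1 (Real.exp_pos _).le)

lemma one_le_H₀ : 1 ≤ H₀ := by
  rw [H₀_eq_integral, ← Real.Gamma_one, ← integral_exp_mul_exp_neg_exp one_pos]
  refine integral_mono_of_nonneg (.of_forall fun w => by positivity) integrable_entropyDensity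
    (.of_forall fun w => ?_)
  simpa only [one_mul] using exp_mul_exp_neg_exp_le_entropyDensity w

lemma one_le_I₀ : 1 ≤ I₀ := by
  rw [I₀_eq_integral, ← Real.Gamma_two, ← integral_exp_mul_exp_neg_exp two_pos]
  refine integral_mono_of_nonneg (.of_forall fun w => by positivity) integrable_fisherDensity
    (.of_forall fun w => ?_)
  simpa only [two_mul, Real.exp_add, ← sq] using sq_exp_mul_exp_neg_exp_le_fisherDensity w

lemma H₀_div_I₀_pos : 0 < H₀ / I₀ :=
  div_pos (one_pos.trans_le one_le_H₀) (one_pos.trans_le one_le_I₀)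

lemma twelve_mul_fisherDensity_le {w : ℝ} (hw : 20 ≤ w) :
    12 * fisherDensity w ≤ entropyDensity (w - Real.log 2) := by
  refine le_trans ?_ (exp_mul_exp_neg_exp_le_entropyDensity _)
  obtain ⟨z, hz⟩ : ∃ z, Real.exp w = 2 * z := ⟨Real.exp w / 2, by ring⟩
  have hz_large : 100 ≤ z := by
    nlinarith [Real.quadratic_le_exp_of_nonneg (show 0 ≤ w by linarith)]
  have h_exp : 48 * z + 1 ≤ Real.exp z := by
    nlinarith [Real.quadratic_le_exp_of_nonneg (show 0 ≤ z by linarith)]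
  have h_sq : Real.exp (2 * z) = Real.exp z ^ 2 := by rw [sq, ← Real.exp_add, two_mul]
  have h_shift : Real.exp (w - Real.log 2) = z := by
    rw [Real.exp_sub, Real.exp_log two_pos, hz]
    ring
  rw [h_shift, fisherDensity, hz, h_sq, ← mul_div_assoc, Real.exp_neg, ← div_eq_mul_inv,
    div_le_div_iff₀ (by nlinarith) (Real.exp_pos z)]
  nlinarith [mul_le_mul_of_nonneg_right h_exp (Real.exp_pos z).le]

lemma exists_crossing {r : ℝ → ℝ} (hr : Antitone r) {a b : ℝ} (hab : a ≤ b) (c : ℝ) :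
    ∃ τ ∈ Icc a b, (∀ x ∈ Ico a τ, c ≤ r x) ∧ ∀ x ∈ Ioc τ b, r x ≤ c := by
  set s := insert a {x ∈ Icc a b | c ≤ r x}
  have h_sub : s ⊆ Icc a b := insert_subset ⟨le_rfl, hab⟩ (sep_subset _ _)
  have h_bdd : BddAbove s := bddAbove_Icc.mono h_sub
  have h_mem : a ∈ s := mem_insert _ _
  refine ⟨sSup s, ⟨le_csSup h_bdd h_mem, csSup_le ⟨a, h_mem⟩ fun x hx => (h_sub hx).2⟩,
    fun x hx => ?_, fun x hx => ?_⟩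
  · obtain ⟨y, rfl | hy, hxy⟩ := exists_lt_of_lt_csSup ⟨a, h_mem⟩ hx.2
    · exact absurd hxy hx.1.not_gt
    · exact hy.2.trans (hr hxy.le)
  · by_contra! h
    have hx_mem : x ∈ s := mem_insert_of_mem _ ⟨⟨(le_csSup h_bdd h_mem).trans hx.1.le, hx.2⟩, h.le⟩
    exact (le_csSup h_bdd hx_mem).not_gt hx.1

section AntitoneRatio

variable {f g k : ℝ → ℝ} {a a' b c : ℝ}

lemma mul_integral_le_of_mul_integral_Ioi_le (hf : Continuous f) (hg : Continuous g)
    (hf_int : Integrable f) (hg_int : Integrable g) (hf0 : ∀ x, 0 ≤ f x) (hg0 : ∀ x, 0 < g x)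
    (hfg : Antitone fun x => f x / g x) (ha : a' ≤ a) (hab : a ≤ b)
    (h : c * ∫ x in Ioi a, g x ≤ ∫ x in Ioi a', f x) :
    c * ∫ x in a..b, g x ≤ ∫ x in a'..b, f x := by
  rcases le_total c (f b / g b) with hb | hb
  · calc c * ∫ x in a..b, g x = ∫ x in a..b, c * g x :=
          (intervalIntegral.integral_const_mul _ _).symm
      _ ≤ ∫ x in a..b, f x :=
          intervalIntegral.integral_mono_on hab ((hg.const_mul c).intervalIntegrable _ _)
            (hf.intervalIntegrable _ _)
            fun x hx => (le_div_iff₀ (hg0 x)).1 (hb.trans (hfg hx.2))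
      _ ≤ ∫ x in a'..b, f x :=
          intervalIntegral.integral_mono_interval ha hab le_rfl (.of_forall hf0)
            (hf.intervalIntegrable _ _)
  · have h_tail : ∫ x in Ioi b, f x ≤ c * ∫ x in Ioi b, g x := by
      rw [← integral_const_mul]
      exact setIntegral_mono_on hf_int.integrableOn (hg_int.const_mul c).integrableOn
        measurableSet_Ioi fun x hx => (div_le_iff₀ (hg0 x)).1 ((hfg (le_of_lt hx)).trans hb)
    rw [← intervalIntegral.integral_interval_add_Ioi (b := b) hf_int.integrableOn
        hf_int.integrableOn,
      ← intervalIntegral.integral_interval_add_Ioi (b := b) hg_int.integrableOn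
        hg_int.integrableOn, mul_add] at h
    linarith

/-- With `τ` the point where `f - c * g` turns negative, `k - k τ` and `f - c * g` have the same
sign everywhere on `[a, b]`, so the weight may be replaced by the constant `k τ`. -/
lemma mul_integral_antitone_mul_le (hf : Continuous f) (hg : Continuous g)
    (hf0 : ∀ x, 0 ≤ f x) (hg0 : ∀ x, 0 < g x) (hfg : Antitone fun x => f x / g x)
    (hk : Antitone k) (hk0 : ∀ x, 0 ≤ k x) (ha : a' ≤ a) (hab : a ≤ b)
    (h : c * ∫ x in a..b, g x ≤ ∫ x in a'..b, f x) :
    c * ∫ x in a..b, k x * g x ≤ ∫ x in a'..b, k x * f x := by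
  obtain ⟨τ, hτ, h_before, h_after⟩ := exists_crossing hfg hab c
  have hfi : ∀ x y, IntervalIntegrable f volume x y := fun x y => hf.intervalIntegrable x y
  have hgi : ∀ x y, IntervalIntegrable g volume x y := fun x y => hg.intervalIntegrable x y
  have hkf : ∀ x y, IntervalIntegrable (fun u => k u * f u) volume x y := fun x y =>
    hk.intervalIntegrable.mul_continuousOn hf.continuousOn
  have hkg : ∀ x y, IntervalIntegrable (fun u => k u * g u) volume x y := fun x y =>
    hk.intervalIntegrable.mul_continuousOn hg.continuousOn
  have h_left : k τ * ∫ x in a'..a, f x ≤ ∫ x in a'..a, k x * f x := by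
    rw [← intervalIntegral.integral_const_mul]
    exact intervalIntegral.integral_mono_on ha ((hfi _ _).const_mul _) (hkf _ _)
      fun x hx => mul_le_mul_of_nonneg_right (hk (hx.2.trans hτ.1)) (hf0 x)
  have h_right : k τ * ((∫ x in a..b, f x) - c * ∫ x in a..b, g x) ≤
      (∫ x in a..b, k x * f x) - c * ∫ x in a..b, k x * g x := by
    rw [← intervalIntegral.integral_const_mul, ← intervalIntegral.integral_const_mul,
      ← intervalIntegral.integral_sub (hfi _ _) ((hgi _ _).const_mul c),
      ← intervalIntegral.integral_sub (hkf _ _) ((hkg _ _).const_mul c),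
      ← intervalIntegral.integral_const_mul]
    refine intervalIntegral.integral_mono_on hab
      (((hfi _ _).sub ((hgi _ _).const_mul c)).const_mul _)
      ((hkf _ _).sub ((hkg _ _).const_mul c)) fun x hx => ?_
    rw [mul_left_comm c, ← mul_sub]
    rcases lt_trichotomy x τ with hxτ | rfl | hxτ
    · exact mul_le_mul_of_nonneg_right (hk hxτ.le)
        (sub_nonneg.2 ((le_div_iff₀ (hg0 x)).1 (h_before x ⟨hx.1, hxτ⟩)))
    · rfl
    · exact mul_le_mul_of_nonpos_right (hk hxτ.le)
        (sub_nonpos.2 ((div_le_iff₀ (hg0 x)).1 (h_after x ⟨hxτ, hx.2⟩)))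
  have h_scaled := mul_le_mul_of_nonneg_left h (hk0 τ)
  rw [← intervalIntegral.integral_add_adjacent_intervals (hfi a' a) (hfi a b)] at h_scaled
  rw [← intervalIntegral.integral_add_adjacent_intervals (hkf a' a) (hkf a b)]
  linarith

end AntitoneRatio

lemma integral_entropyDensity_Iic_le {w : ℝ} (hw : w ≤ 0) :
    ∫ v in Iic w, entropyDensity v ≤ 6 * Real.exp (w / 2) := by
  calc ∫ v in Iic w, entropyDensity v ≤ ∫ v in Iic w, 3 * Real.exp (1 / 2 * v) := by
        refine setIntegral_mono_on integrable_entropyDensity.integrableOn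
          ((integrableOn_exp_mul_Iic one_half_pos w).const_mul 3) measurableSet_Iic fun v hv => ?_
        have h := entropyDensity_le v
        rwa [abs_of_nonpos ((mem_Iic.1 hv).trans hw), neg_neg, ← one_div_mul_eq_div] at h
    _ = 6 * Real.exp (w / 2) := by
        rw [integral_const_mul, integral_exp_mul_Iic one_half_pos, one_div_mul_eq_div]
        ring

lemma six_mul_exp_le_one {D : ℝ} (hD : 40 ≤ D) : 6 * Real.exp (-D / 4) ≤ 1 := by
  rw [neg_div, Real.exp_neg, ← div_eq_mul_inv, div_le_one (Real.exp_pos _)]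
  linarith [Real.add_one_le_exp (D / 4)]

lemma setIntegral_entropyDensity_Ioi_mono {v w : ℝ} (h : v ≤ w) :
    ∫ u in Ioi w, entropyDensity u ≤ ∫ u in Ioi v, entropyDensity u :=
  setIntegral_mono_set integrable_entropyDensity.integrableOn
    (.of_forall fun w => (entropyDensity_pos w).le) (Ioi_subset_Ioi h).eventuallyLE

section TailComparison

variable {A D : ℝ}

lemma integral_fisherDensity_Ioi_le_of_le (hD : 40 ≤ D) (hA : A ≤ D / 2) :
    (1 - 6 * Real.exp (-D / 4)) * (H₀ / I₀) * ∫ w in Ioi A, fisherDensity w ≤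
      ∫ w in Ioi (A - D), entropyDensity w := by
  have h_fisher : ∫ w in Ioi A, fisherDensity w ≤ I₀ :=
    setIntegral_le_integral integrable_fisherDensity (.of_forall fun w => (fisherDensity_pos w).le)
  have h_tail := integral_entropyDensity_Iic_le (w := -D / 2) (by linarith)
  have h_split := integral_add_compl (measurableSet_Iic (a := -D / 2)) integrable_entropyDensity
  rw [compl_Iic, ← H₀_eq_integral] at h_split
  have h_factor : 0 ≤ 1 - 6 * Real.exp (-D / 4) := sub_nonneg.2 (six_mul_exp_le_one hD)
  have hI₀ : 0 < I₀ := one_pos.trans_le one_le_I₀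
  calc (1 - 6 * Real.exp (-D / 4)) * (H₀ / I₀) * ∫ w in Ioi A, fisherDensity w
      ≤ (1 - 6 * Real.exp (-D / 4)) * (H₀ / I₀) * I₀ := by
        have := H₀_div_I₀_pos
        gcongr
    _ = H₀ - 6 * Real.exp (-D / 4) * H₀ := by field_simp
    _ ≤ H₀ - 6 * Real.exp (-D / 4) :=
        sub_le_sub_left (le_mul_of_one_le_right (by positivity) one_le_H₀) _
    _ = H₀ - 6 * Real.exp (-D / 2 / 2) := by ring_nf
    _ ≤ ∫ w in Ioi (-D / 2), entropyDensity w := by linarith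
    _ ≤ ∫ w in Ioi (A - D), entropyDensity w := setIntegral_entropyDensity_Ioi_mono (by linarith)

lemma integral_fisherDensity_Ioi_le_of_ge (hD : 40 ≤ D) (hA : D / 2 ≤ A) :
    (1 - 6 * Real.exp (-D / 4)) * (H₀ / I₀) * ∫ w in Ioi A, fisherDensity w ≤
      ∫ w in Ioi (A - D), entropyDensity w := by
  have h_const : (1 - 6 * Real.exp (-D / 4)) * (H₀ / I₀) ≤ 12 :=
    calc (1 - 6 * Real.exp (-D / 4)) * (H₀ / I₀) ≤ H₀ / I₀ :=
          mul_le_of_le_one_left H₀_div_I₀_pos.le (sub_le_self 1 (by positivity))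
      _ ≤ 12 := (div_le_self (one_pos.trans_le one_le_H₀).le one_le_I₀).trans H₀_le
  calc (1 - 6 * Real.exp (-D / 4)) * (H₀ / I₀) * ∫ w in Ioi A, fisherDensity w
      ≤ 12 * ∫ w in Ioi A, fisherDensity w :=
        mul_le_mul_of_nonneg_right h_const
          (setIntegral_nonneg measurableSet_Ioi fun w _ => (fisherDensity_pos w).le)
    _ = ∫ w in Ioi A, 12 * fisherDensity w := (integral_const_mul _ _).symm
    _ ≤ ∫ w in Ioi A, entropyDensity (w - Real.log 2) :=
        setIntegral_mono_on (integrable_fisherDensity.const_mul 12).integrableOn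
          (integrable_entropyDensity.comp_sub_right _).integrableOn measurableSet_Ioi
          fun w hw => twelve_mul_fisherDensity_le (by linarith [mem_Ioi.1 hw])
    _ = ∫ w in Ioi (A - Real.log 2), entropyDensity w := by
        simpa only [sub_eq_add_neg, image_add_const_Ioi] using
          ((measurePreserving_add_right volume (-Real.log 2)).setIntegral_image_emb
            (measurableEmbedding_addRight _) entropyDensity (Ioi A)).symm
    _ ≤ ∫ w in Ioi (A - D), entropyDensity w :=
        setIntegral_entropyDensity_Ioi_mono (by linarith [Real.log_two_lt_d9])

lemma integral_fisherDensity_Ioi_le (hD : 40 ≤ D) (A : ℝ) :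
    (1 - 6 * Real.exp (-D / 4)) * (H₀ / I₀) * ∫ w in Ioi A, fisherDensity w ≤
      ∫ w in Ioi (A - D), entropyDensity w :=
  (le_total A (D / 2)).elim (integral_fisherDensity_Ioi_le_of_le hD)
    (integral_fisherDensity_Ioi_le_of_ge hD)

end TailComparison

lemma integral_mul_fisherDensity_le {k : ℝ → ℝ} (hk : Antitone k) (hk0 : ∀ x, 0 ≤ k x)
    {a b D : ℝ} (hab : a ≤ b) (hD : 40 ≤ D) (w : ℝ) :
    (1 - 6 * Real.exp (-D / 4)) * (H₀ / I₀) * ∫ x in a..b, k x * fisherDensity (x + w) ≤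
      ∫ x in (a - D)..b, k x * entropyDensity (x + w) := by
  have h_trunc : (1 - 6 * Real.exp (-D / 4)) * (H₀ / I₀) *
      ∫ x in (a + w)..(b + w), fisherDensity x ≤ ∫ x in (a + w - D)..(b + w), entropyDensity x :=
    mul_integral_le_of_mul_integral_Ioi_le continuous_entropyDensity continuous_fisherDensity
      integrable_entropyDensity integrable_fisherDensity (fun x => (entropyDensity_pos x).le)
      fisherDensity_pos entropyDensity_div_fisherDensity_antitone (by linarith) (by linarith)
      (integral_fisherDensity_Ioi_le hD (a + w))
  have h := mul_integral_antitone_mul_le (k := fun x => k (x - w)) continuous_entropyDensity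
    continuous_fisherDensity (fun x => (entropyDensity_pos x).le) fisherDensity_pos
    entropyDensity_div_fisherDensity_antitone (fun x y hxy => hk (sub_le_sub_right hxy w))
    (fun x => hk0 _) (by linarith) (by linarith) h_trunc
  rw [← sub_add_eq_add_sub a D w, ← intervalIntegral.integral_comp_add_right,
    ← intervalIntegral.integral_comp_add_right] at h
  simpa only [add_sub_cancel_right] using h

section Information

variable {α β : Type*} [Fintype α] [Fintype β]

lemma shannonEntropy_comp_equiv (e : α ≃ β) (f : β → ℝ) :
    shannonEntropy (fun x => f (e x)) = shannonEntropy f :=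
  e.sum_comp fun y => f y * -Real.logb 2 (f y)

lemma fisherInformation_comp_equiv (e : α ≃ β) (f : ℝ → β → ℝ) (t : ℝ) :
    fisherInformation (fun s x => f s (e x)) t = fisherInformation f t :=
  e.sum_comp fun y => f t y * (deriv (fun s => f s y) t / f t y) ^ 2

lemma shannonEntropy_mul_kernel (f : α → ℝ) {g : α → β → ℝ} (hg : ∀ a, ∑ b, g a b = 1) :
    shannonEntropy (fun x : α × β => f x.1 * g x.1 x.2) =
      shannonEntropy f + ∑ a, f a * shannonEntropy (g a) := by
  have h_term : ∀ a b, f a * g a b * -Real.logb 2 (f a * g a b) =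
      g a b * (f a * -Real.logb 2 (f a)) + f a * (g a b * -Real.logb 2 (g a b)) := by
    intro a b
    rcases eq_or_ne (f a) 0 with hf | hf
    · simp only [hf, zero_mul, mul_zero, add_zero]
    rcases eq_or_ne (g a b) 0 with hgab | hgab
    · simp only [hgab, zero_mul, mul_zero, add_zero]
    rw [Real.logb_mul hf hgab]
    ring
  simp only [shannonEntropy, Fintype.sum_prod_type, h_term, Finset.sum_add_distrib,
    ← Finset.sum_mul, ← Finset.mul_sum, hg, one_mul]

lemma fisherInformation_mul_kernel {f : ℝ → α → ℝ} {g : ℝ → α → β → ℝ} {t : ℝ}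
    (hf : ∀ a, DifferentiableAt ℝ (fun s => f s a) t)
    (hg : ∀ a b, DifferentiableAt ℝ (fun s => g s a b) t)
    (hg_sum : ∀ s a, ∑ b, g s a b = 1)
    (hg_zero : ∀ a b, g t a b = 0 → deriv (fun s => g s a b) t = 0) :
    fisherInformation (fun s (x : α × β) => f s x.1 * g s x.1 x.2) t =
      fisherInformation f t + ∑ a, f t a * fisherInformation (fun s => g s a) t := by
  have h_deriv_sum : ∀ a, ∑ b, deriv (fun s => g s a b) t = 0 := fun a => by
    rw [← deriv_fun_sum fun b _ => hg a b]
    simp only [hg_sum, deriv_const]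
  have h_deriv : ∀ a b, deriv (fun s => f s a * g s a b) t =
      deriv (fun s => f s a) t * g t a b + f t a * deriv (fun s => g s a b) t :=
    fun a b => deriv_fun_mul (hf a) (hg a b)
  simp only [fisherInformation, Fintype.sum_prod_type, h_deriv, ← Finset.sum_add_distrib]
  refine Finset.sum_congr rfl fun a _ => ?_
  rcases eq_or_ne (f t a) 0 with hfa | hfa
  · simp only [hfa, zero_mul, Finset.sum_const_zero, add_zero]
  have h_term : ∀ b, f t a * g t a b * ((deriv (fun s => f s a) t * g t a b +
      f t a * deriv (fun s => g s a b) t) / (f t a * g t a b)) ^ 2 =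
      g t a b * (f t a * (deriv (fun s => f s a) t / f t a) ^ 2) +
        deriv (fun s => g s a b) t * (2 * deriv (fun s => f s a) t) +
        f t a * (g t a b * (deriv (fun s => g s a b) t / g t a b) ^ 2) := by
    intro b
    rcases eq_or_ne (g t a b) 0 with hgab | hgab
    · simp only [hgab, hg_zero a b hgab, zero_mul, mul_zero, add_zero]
    field_simp
    ring
  simp only [h_term, Finset.sum_add_distrib, ← Finset.sum_mul, ← Finset.mul_sum, hg_sum,
    h_deriv_sum, one_mul, zero_mul, add_zero]

end Information

/-- The mass function of the bit `Z ∨ b`, where `Z` is a random bit that vanishes with probability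
`q`: the conditional law of `Y i` given that `φ (Y 0, …, Y (i-1)) = b`. -/
noncomputable def bitProb (q : ℝ) (b y : Bool) : ℝ :=
  if b then (if y then 1 else 0) else (if y then 1 - q else q)

section Bit

variable {q q' : ℝ}

lemma bitProb_nonneg (h0 : 0 ≤ q) (h1 : q ≤ 1) (b y : Bool) : 0 ≤ bitProb q b y := by
  unfold bitProb
  split_ifs <;> linarith

lemma sum_bitProb (q : ℝ) (b : Bool) : ∑ y, bitProb q b y = 1 := by
  cases b <;> simp [bitProb]

lemma shannonEntropy_bitProb (q : ℝ) (b : Bool) :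
    shannonEntropy (bitProb q b) = if b then 0 else hNat q / Real.log 2 := by
  rw [shannonEntropy, Fintype.sum_bool]
  cases b
  · simp only [bitProb, if_true, if_false, Bool.false_eq_true, Real.logb, hNat]
    ring
  · simp [bitProb]

lemma sum_bitProb_mul_le (h0 : 0 ≤ q) (hq : q ≤ q') (h1 : q' ≤ 1) {b b' : Bool} (hb : b' ≤ b)
    {u u' : Bool → ℝ} (hu : u ≤ u') (hu' : Antitone u') :
    ∑ y, bitProb q b y * u y ≤ ∑ y, bitProb q' b' y * u' y := by
  have h_true := hu true
  have h_false := hu false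
  have h_anti := hu' (Bool.false_le true)
  rw [Fintype.sum_bool, Fintype.sum_bool]
  cases b <;> cases b'
  · simp only [bitProb, if_true, if_false, Bool.false_eq_true]
    nlinarith
  · exact absurd hb (by decide)
  · simp only [bitProb, if_true, if_false, Bool.false_eq_true]
    nlinarith
  · simpa only [bitProb, if_true, if_false, Bool.false_eq_true, one_mul, zero_mul, add_zero]

variable {p : ℝ → ℝ} {t : ℝ}

lemma differentiableAt_bitProb (hp : DifferentiableAt ℝ p t) (b y : Bool) :
    DifferentiableAt ℝ (fun s => bitProb (p s) b y) t := by
  cases b <;> cases y <;> simp only [bitProb, if_true, if_false, Bool.false_eq_true] <;> fun_prop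

lemma deriv_bitProb (p : ℝ → ℝ) (t : ℝ) (b y : Bool) :
    deriv (fun s => bitProb (p s) b y) t =
      if b then 0 else if y then -deriv p t else deriv p t := by
  cases b <;> cases y <;>
    simp only [bitProb, if_true, if_false, Bool.false_eq_true, deriv_const, deriv_const_sub]

lemma deriv_bitProb_of_eq_zero (h0 : p t = 0 → deriv p t = 0) (h1 : p t = 1 → deriv p t = 0)
    {b y : Bool} (h : bitProb (p t) b y = 0) : deriv (fun s => bitProb (p s) b y) t = 0 := by
  rw [deriv_bitProb]
  cases b <;> cases y <;> simp only [bitProb, if_true, if_false, Bool.false_eq_true] at h ⊢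
  · exact h0 h
  · rw [h1 (sub_eq_zero.1 h).symm, neg_zero]

lemma fisherInformation_bitProb (h0 : p t = 0 → deriv p t = 0) (h1 : p t = 1 → deriv p t = 0)
    (b : Bool) :
    fisherInformation (fun s => bitProb (p s) b) t =
      if b then 0 else deriv p t ^ 2 / (p t * (1 - p t)) := by
  rw [fisherInformation, Fintype.sum_bool, deriv_bitProb, deriv_bitProb]
  cases b
  · simp only [bitProb, if_true, if_false, Bool.false_eq_true]
    rcases eq_or_ne (p t) 0 with h | h_zero
    · simp [h0 h]
    rcases eq_or_ne (p t) 1 with h | h_one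
    · simp [h1 h]
    have h_sub := sub_ne_zero.2 h_one.symm
    field_simp
    ring
  · simp

end Bit

/-- Splitting a nonempty word into its initial part and its last bit. -/
def snocWord (n : ℕ) : (Fin n → Bool) × Bool ≃ (Fin (n + 1) → Bool) :=
  (Equiv.prodComm _ _).trans (Fin.snocEquiv fun _ => Bool)

/-- The probability that the words `Y 0, …, Y (n-1)` generated by `Y i = Z i ∨ φ (Y 0, …, Y (i-1))`,
for independent bits `Z i` that vanish with probability `q i`, equals `y`. -/
noncomputable def wordProb (φ : (i : ℕ) → (Fin i → Bool) → Bool) (q : ℕ → ℝ) (n : ℕ)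
    (y : Fin n → Bool) : ℝ :=
  ∏ i : Fin n, bitProb (q i) (φ i fun j => y (j.castLE i.isLt.le)) (y i)

/-- The probability that the `n`-th bit is not forced, `φ (Y 0, …, Y (n-1)) = 0`. -/
noncomputable def freeProb (φ : (i : ℕ) → (Fin i → Bool) → Bool) (q : ℕ → ℝ) (n : ℕ) : ℝ :=
  ∑ y, wordProb φ q n y * if φ n y then 0 else 1

section Word

variable {φ : (i : ℕ) → (Fin i → Bool) → Bool} {q q' : ℕ → ℝ}

lemma wordProb_snocWord (φ : (i : ℕ) → (Fin i → Bool) → Bool) (q : ℕ → ℝ) (n : ℕ)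
    (x : (Fin n → Bool) × Bool) :
    wordProb φ q (n + 1) (snocWord n x) = wordProb φ q n x.1 * bitProb (q n) (φ n x.1) x.2 := by
  have h_init : ∀ i : Fin n, snocWord n x i.castSucc = x.1 i := fun i =>
    Fin.snoc_castSucc (α := fun _ => Bool) _ _ _
  have h_last : snocWord n x (Fin.last n) = x.2 := Fin.snoc_last (α := fun _ => Bool) _ _
  rw [wordProb, Fin.prod_univ_castSucc, h_last]
  simp only [h_init]
  congr 1
  · exact Finset.prod_congr rfl fun i _ => by
      congr 2
      exact funext fun j => h_init (j.castLE i.isLt.le)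
  · congr 2
    exact funext h_init

lemma wordProb_nonneg (h0 : 0 ≤ q) (h1 : q ≤ 1) (n : ℕ) (y : Fin n → Bool) :
    0 ≤ wordProb φ q n y :=
  Finset.prod_nonneg fun i _ => bitProb_nonneg (h0 i) (h1 i) _ _

lemma freeProb_nonneg (h0 : 0 ≤ q) (h1 : q ≤ 1) (n : ℕ) : 0 ≤ freeProb φ q n :=
  Finset.sum_nonneg fun y _ =>
    mul_nonneg (wordProb_nonneg h0 h1 n y) (ite_nonneg le_rfl zero_le_one)

lemma sum_wordProb_mul_ite (φ : (i : ℕ) → (Fin i → Bool) → Bool) (q : ℕ → ℝ) (n : ℕ) (x : ℝ) :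
    ∑ y, wordProb φ q n y * (if φ n y then 0 else x) = freeProb φ q n * x := by
  simp only [freeProb, Finset.sum_mul, mul_assoc, ite_mul, zero_mul, one_mul]

lemma shannonEntropy_wordProb (φ : (i : ℕ) → (Fin i → Bool) → Bool) (q : ℕ → ℝ) (n : ℕ) :
    shannonEntropy (wordProb φ q n) =
      ∑ i ∈ Finset.range n, freeProb φ q i * (hNat (q i) / Real.log 2) := by
  induction n with
  | zero => simp [shannonEntropy, wordProb]
  | succ n ih =>
    rw [← shannonEntropy_comp_equiv (snocWord n), Finset.sum_range_succ, ← ih]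
    simp only [wordProb_snocWord]
    rw [shannonEntropy_mul_kernel (wordProb φ q n) (g := fun y => bitProb (q n) (φ n y))
      fun y => sum_bitProb _ _]
    simp only [shannonEntropy_bitProb, sum_wordProb_mul_ite]

lemma fisherInformation_wordProb (φ : (i : ℕ) → (Fin i → Bool) → Bool) {p : ℕ → ℝ → ℝ} {t : ℝ}
    (hp : ∀ i, DifferentiableAt ℝ (p i) t) (h0 : ∀ i, p i t = 0 → deriv (p i) t = 0)
    (h1 : ∀ i, p i t = 1 → deriv (p i) t = 0) (n : ℕ) :
    fisherInformation (fun s => wordProb φ (fun i => p i s) n) t =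
      ∑ i ∈ Finset.range n,
        freeProb φ (fun i => p i t) i * (deriv (p i) t ^ 2 / (p i t * (1 - p i t))) := by
  induction n with
  | zero => simp [fisherInformation, wordProb]
  | succ n ih =>
    rw [← fisherInformation_comp_equiv (snocWord n), Finset.sum_range_succ, ← ih]
    simp only [wordProb_snocWord]
    rw [fisherInformation_mul_kernel (f := fun s => wordProb φ (fun i => p i s) n)
      (g := fun s y => bitProb (p n s) (φ n y))]
    · simp only [fisherInformation_bitProb (h0 n) (h1 n), sum_wordProb_mul_ite]
    · exact fun y => DifferentiableAt.fun_finsetProd fun i _ =>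
        differentiableAt_bitProb (hp i) _ _
    · exact fun y => differentiableAt_bitProb (hp n) _
    · exact fun s y => sum_bitProb _ _
    · exact fun y b hb => deriv_bitProb_of_eq_zero (h0 n) (h1 n) hb

lemma snocWord_mono {n : ℕ} : Monotone (snocWord n) := fun v w hvw i =>
  Fin.lastCases (motive := fun i => snocWord n v i ≤ snocWord n w i)
    (by simpa [snocWord] using hvw.2) (fun j => by simpa [snocWord] using hvw.1 j) i

lemma sum_wordProb_mul_le_of_antitone (hφ : ∀ i, Monotone (φ i)) (h0 : 0 ≤ q) (hq : q ≤ q')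
    (h1 : q' ≤ 1) {n : ℕ} {F : (Fin n → Bool) → ℝ} (hF : Antitone F) :
    ∑ y, wordProb φ q n y * F y ≤ ∑ y, wordProb φ q' n y * F y := by
  induction n with
  | zero => simp [wordProb]
  | succ n ih =>
    have h_split : ∀ p : ℕ → ℝ, ∑ y, wordProb φ p (n + 1) y * F y =
        ∑ w, wordProb φ p n w * ∑ b, bitProb (p n) (φ n w) b * F (snocWord n (w, b)) := by
      intro p
      simp only [← (snocWord n).sum_comp, Fintype.sum_prod_type, wordProb_snocWord, Finset.mul_sum,
        mul_assoc]
    have h_anti : Antitone fun x => F (snocWord n x) := hF.comp_monotone snocWord_mono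
    have h_anti_right : ∀ w, Antitone fun b => F (snocWord n (w, b)) := fun w b c hbc =>
      h_anti ⟨le_rfl, hbc⟩
    rw [h_split, h_split]
    calc ∑ w, wordProb φ q n w * ∑ b, bitProb (q n) (φ n w) b * F (snocWord n (w, b))
        ≤ ∑ w, wordProb φ q' n w * ∑ b, bitProb (q n) (φ n w) b * F (snocWord n (w, b)) :=
          ih fun v w hvw => sum_bitProb_mul_le (h0 n) le_rfl ((hq n).trans (h1 n)) (hφ n hvw)
            (fun b => h_anti ⟨hvw, le_rfl⟩) (h_anti_right v)
      _ ≤ ∑ w, wordProb φ q' n w * ∑ b, bitProb (q' n) (φ n w) b * F (snocWord n (w, b)) := by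
          gcongr ∑ w, _ * ?_ with w
          · exact wordProb_nonneg (h0.trans hq) h1 n w
          · exact sum_bitProb_mul_le (h0 n) (hq n) (h1 n) le_rfl le_rfl (h_anti_right w)

lemma freeProb_mono (hφ : ∀ i, Monotone (φ i)) (h0 : 0 ≤ q) (hq : q ≤ q') (h1 : q' ≤ 1) (n : ℕ) :
    freeProb φ q n ≤ freeProb φ q' n := by
  refine sum_wordProb_mul_le_of_antitone hφ h0 hq h1 fun v w hvw => ?_
  split_ifs with hw hv hv
  · rfl
  · exact zero_le_one
  · exact absurd (hφ n hvw hv) hw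
  · rfl

end Word

lemma eq_of_sum_le_eq {α : Type*} [PartialOrder α] [Fintype α] [DecidableLE α] {M : Type*}
    [AddCancelCommMonoid M] {f g : α → M}
    (h : ∀ b, ∑ a with a ≤ b, f a = ∑ a with a ≤ b, g a) : f = g := by
  classical
  ext b
  induction b using WellFoundedLT.induction with
  | ind b ih =>
    have h_insert : Finset.univ.filter (· ≤ b) = insert b (Finset.univ.filter (· < b)) := by
      ext a
      simp [le_iff_eq_or_lt]
    have h_lt : ∑ a with a < b, f a = ∑ a with a < b, g a :=
      Finset.sum_congr rfl fun a ha => ih a (Finset.mem_filter_univ a |>.1 ha)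
    have hb := h b
    rw [h_insert, Finset.sum_insert (by simp), Finset.sum_insert (by simp), h_lt] at hb
    exact add_right_cancel hb

lemma sum_prod_of_mem_iff {ι κ : Type*} [Fintype ι] {s : Finset (ι → κ)} {u : ι → Finset κ}
    (hs : ∀ z, z ∈ s ↔ ∀ i, z i ∈ u i) {R : Type*} [CommSemiring R] (m : ι → κ → R) :
    ∑ z ∈ s, ∏ i, m i (z i) = ∏ i, ∑ y ∈ u i, m i y := by
  classical
  rw [Finset.prod_univ_sum]
  congr 1
  ext z
  rw [hs, Fintype.mem_piFinset]

section HitWord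

variable {Ω ι : Type*} {A : ι → Set Ω} {k : ℕ}

open scoped Classical in
/-- The word recording which of the sets `A i` are hit by the sample `x`. -/
noncomputable def hitWord (A : ι → Set Ω) (x : Fin k → Ω) : ι → Bool :=
  fun i => decide (∃ j, x j ∈ A i)

lemma hitWord_apply {x : Fin k → Ω} {i : ι} : hitWord A x i = true ↔ ∃ j, x j ∈ A i := by
  simp only [hitWord, decide_eq_true_eq]

lemma hitWord_le_iff {x : Fin k → Ω} {z : ι → Bool} :
    hitWord A x ≤ z ↔ ∀ j, x j ∈ (⋃ i ∈ {i | z i = false}, A i)ᶜ := by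
  simp only [mem_compl_iff, mem_iUnion, mem_ofPred_eq, not_exists, Pi.le_def, Bool.le_iff_imp,
    hitWord_apply]
  constructor
  · intro h j i hi hj
    exact Bool.false_ne_true (hi.symm.trans (h i ⟨j, hj⟩))
  · rintro h i ⟨j, hj⟩
    exact (Bool.eq_false_or_eq_true (z i)).resolve_right fun hi => h j i hi hj

lemma measurable_hitWord [MeasurableSpace Ω] (hA : ∀ i, MeasurableSet (A i)) :
    Measurable (hitWord A (k := k)) := by
  refine measurable_pi_iff.2 fun i => measurable_to_bool ?_
  have h_union : (fun x : Fin k → Ω => hitWord A x i) ⁻¹' {true} =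
      ⋃ j, (fun x : Fin k → Ω => x j) ⁻¹' A i := by
    ext x
    simp [hitWord_apply]
  rw [h_union]
  exact MeasurableSet.iUnion fun j => measurable_pi_apply j (hA i)

end HitWord

section Poissonization

variable {Ω : Type*} [MeasurableSpace Ω] (μ : Measure Ω) [IsProbabilityMeasure μ] (t : ℝ)

/-- The probability of the event `E` for a `Poisson(t)` number `k` of independent samples from `μ`,
where `E k` is the event given that there are `k` samples. -/
noncomputable def poissonProb (E : ∀ k, Set (Fin k → Ω)) : ℝ :=
  ∑' k : ℕ, Real.exp (-t) * t ^ k / (k.factorial : ℝ) * (Measure.pi fun _ => μ).real (E k)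

lemma summable_poissonProb (E : ∀ k, Set (Fin k → Ω)) :
    Summable fun k : ℕ =>
      Real.exp (-t) * t ^ k / (k.factorial : ℝ) * (Measure.pi fun _ => μ).real (E k) := by
  refine Summable.of_norm_bounded ((Real.summable_pow_div_factorial |t|).mul_left (Real.exp (-t)))
    fun k => ?_
  rw [norm_mul, Real.norm_of_nonneg measureReal_nonneg, mul_div_assoc, norm_mul, norm_div,
    norm_pow, Real.norm_of_nonneg (Real.exp_pos _).le, Real.norm_natCast, Real.norm_eq_abs]
  exact mul_le_of_le_one_right (by positivity) measureReal_le_one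

lemma sum_poissonProb_eq {β : Type*} [MeasurableSpace β] [MeasurableSingletonClass β]
    {f : ∀ k, (Fin k → Ω) → β} (hf : ∀ k, Measurable (f k)) (s : Finset β) :
    ∑ z ∈ s, poissonProb μ t (fun k => {x | f k x = z}) =
      poissonProb μ t fun k => {x | f k x ∈ s} := by
  simp only [poissonProb]
  rw [← Summable.tsum_finsetSum fun z _ => summable_poissonProb μ t _]
  refine tsum_congr fun k => ?_
  rw [← Finset.mul_sum]
  congr 1
  exact sum_measureReal_preimage_singleton s fun z _ => hf k (measurableSet_singleton z)

lemma poissonProb_forall_mem (B : Set Ω) :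
    poissonProb μ t (fun _ => {x | ∀ j, x j ∈ B}) = Real.exp (-(t * (1 - μ.real B))) := by
  have h_term : ∀ k : ℕ, Real.exp (-t) * t ^ k / (k.factorial : ℝ) *
      (Measure.pi fun _ : Fin k => μ).real {x | ∀ j, x j ∈ B} =
      Real.exp (-t) * ((t * μ.real B) ^ k / (k.factorial : ℝ)) := by
    intro k
    have h_pi : {x : Fin k → Ω | ∀ j, x j ∈ B} = univ.pi fun _ => B := by
      ext x
      simp only [mem_univ_pi, mem_ofPred_eq]
    rw [h_pi, measureReal_def, Measure.pi_pi, ENNReal.toReal_prod, Finset.prod_const,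
      Finset.card_univ, Fintype.card_fin, ← measureReal_def, mul_pow]
    ring
  have h_exp : ∑' k : ℕ, (t * μ.real B) ^ k / (k.factorial : ℝ) = Real.exp (t * μ.real B) := by
    rw [Real.exp_eq_exp_ℝ, NormedSpace.exp_eq_tsum_div]
  simp only [poissonProb, h_term]
  rw [tsum_mul_left, h_exp, ← Real.exp_add]
  congr 1
  ring

variable {ι : Type*} {A : ι → Set Ω}

/-- Poisson splitting. -/
lemma poissonProb_hitWord_eq [Fintype ι] (hA : ∀ i, MeasurableSet (A i))
    (hdisj : Pairwise (Function.onFun Disjoint A)) (z : ι → Bool) :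
    poissonProb μ t (fun _ => {x | hitWord A x = z}) =
      ∏ i, bitProb (Real.exp (-(t * μ.real (A i)))) false (z i) := by
  classical
  refine congrFun (eq_of_sum_le_eq (f := fun z => poissonProb μ t fun _ => {x | hitWord A x = z})
    (g := fun z => ∏ i, bitProb (Real.exp (-(t * μ.real (A i)))) false (z i)) fun b => ?_) z
  have h_bit : ∀ (q : ℝ) (c : Bool),
      ∑ y with y ≤ c, bitProb q false y = if c = false then q else 1 := by
    intro q c
    rw [Finset.sum_filter]
    cases c <;> simp [bitProb]
  have h_missed : 1 - μ.real (⋃ i ∈ {i | b i = false}, A i)ᶜ =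
      ∑ i with b i = false, μ.real (A i) := by
    have h_union := measureReal_biUnion_finset (μ := μ) (s := Finset.univ.filter (b · = false))
      (fun i _ j _ hij => hdisj hij) fun i _ => hA i
    simp only [Finset.mem_filter_univ] at h_union
    rw [probReal_compl_eq_one_sub (MeasurableSet.biUnion (to_countable _) fun i _ => hA i),
      sub_sub_cancel, ← h_union]
    rfl
  calc ∑ z with z ≤ b, poissonProb μ t (fun _ => {x | hitWord A x = z})
      = poissonProb μ t (fun _ => {x | hitWord A x ≤ b}) := by
        rw [sum_poissonProb_eq μ t fun k => measurable_hitWord hA]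
        simp only [Finset.mem_filter_univ]
    _ = Real.exp (-(t * ∑ i with b i = false, μ.real (A i))) := by
        simp only [hitWord_le_iff]
        rw [poissonProb_forall_mem, h_missed]
    _ = ∏ i, if b i = false then Real.exp (-(t * μ.real (A i))) else 1 := by
        rw [← Finset.prod_filter, ← Real.exp_sum, Finset.mul_sum, Finset.sum_neg_distrib]
    _ = ∑ z with z ≤ b, ∏ i, bitProb (Real.exp (-(t * μ.real (A i)))) false (z i) := by
        rw [sum_prod_of_mem_iff (u := fun i => Finset.univ.filter (· ≤ b i)) fun z => by
          simp only [Finset.mem_filter_univ, Pi.le_def]]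
        simp only [h_bit]

end Poissonization

lemma eq_of_prefix_recursion {α : Type*} {n : ℕ} {F : (i : Fin n) → (Fin i → α) → α}
    {y y' : Fin n → α} (hy : ∀ i, y i = F i fun j => y (j.castLE i.isLt.le))
    (hy' : ∀ i, y' i = F i fun j => y' (j.castLE i.isLt.le)) : y = y' := by
  ext i
  induction i using WellFoundedLT.induction with
  | ind i ih =>
    rw [hy, hy']
    congr 1
    exact funext fun j => ih _ j.isLt

lemma sum_prod_bitProb_eq_wordProb (φ : (i : ℕ) → (Fin i → Bool) → Bool) (q : ℕ → ℝ) {n : ℕ}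
    (y : Fin n → Bool) :
    ∑ z : Fin n → Bool with ∀ i, y i = (z i || φ i fun j => y (j.castLE i.isLt.le)),
      ∏ i : Fin n, bitProb (q i) false (z i) = wordProb φ q n y := by
  rw [sum_prod_of_mem_iff (m := fun i => bitProb (q i) false) (u := fun i =>
    Finset.univ.filter fun b => y i = (b || φ i fun j => y (j.castLE i.isLt.le))) fun z => by
      simp only [Finset.mem_filter_univ]]
  refine Finset.prod_congr rfl fun i _ => ?_
  rw [Finset.sum_filter, Fintype.sum_bool]
  cases y i <;> cases φ i (fun j => y (j.castLE i.isLt.le)) <;> simp [bitProb]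

namespace DartboardSketch

variable {C : Type*} [Fintype C]

open scoped Classical in
/-- States as words: the `i`-th bit says whether the `i`-th cell is occupied. -/
noncomputable def stateWord (c : Fin (Fintype.card C) ≃ C) :
    Finset C ≃ (Fin (Fintype.card C) → Bool) where
  toFun σ i := decide (c i ∈ σ)
  invFun y := Finset.univ.filter fun a => y (c.symm a) = true
  left_inv σ := by
    ext a
    simp
  right_inv y := by
    ext i
    simp

lemma stateWord_apply {c : Fin (Fintype.card C) ≃ C} {σ : Finset C} {i : Fin (Fintype.card C)} :
    stateWord c σ i = true ↔ c i ∈ σ := by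
  simp only [stateWord, Equiv.coe_fn_mk, decide_eq_true_eq]

lemma stateProb_eq_wordProb (S : DartboardSketch C) (c : Fin (Fintype.card C) ≃ C)
    {φ : (i : ℕ) → (Fin i → Bool) → Bool}
    (hφ : ∀ (k : ℕ) (x : Fin k → Dartboard) (i : Fin (Fintype.card C)),
      c i ∈ S.stateAfter x ↔ (∃ j, S.cellOf (x j) = c i) ∨
        φ i (fun j => stateWord c (S.stateAfter x) (j.castLE i.isLt.le)) = true)
    {p : ℕ → ℝ} (hp : ∀ i : Fin (Fintype.card C), p i = volume.real (S.cellOf ⁻¹' {c i}))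
    (t : ℝ) (σ : Finset C) :
    S.stateProb t σ = wordProb φ (fun i => Real.exp (-(t * p i))) _ (stateWord c σ) := by
  set A : Fin (Fintype.card C) → Set Dartboard := fun i => S.cellOf ⁻¹' {c i} with hA_def
  have hA : ∀ i, MeasurableSet (A i) := fun i => S.measurableSet_cell (c i)
  have hdisj : Pairwise (Function.onFun Disjoint A) := fun i j hij =>
    (disjoint_singleton.2 (c.injective.ne hij)).preimage _
  have h_rec : ∀ (k : ℕ) (x : Fin k → Dartboard) (i : Fin (Fintype.card C)),
      stateWord c (S.stateAfter x) i =
        (hitWord A x i || φ i fun j => stateWord c (S.stateAfter x) (j.castLE i.isLt.le)) := by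
    intro k x i
    rw [Bool.eq_iff_iff, Bool.or_eq_true, hitWord_apply, stateWord_apply]
    exact hφ k x i
  set y := stateWord c σ
  have h_event : ∀ (k : ℕ) (x : Fin k → Dartboard), S.stateAfter x = σ ↔
      ∀ i, y i = (hitWord A x i || φ i fun j => y (j.castLE i.isLt.le)) := by
    refine fun k x => ⟨?_, fun h => (stateWord c).injective ?_⟩
    · rintro rfl
      exact h_rec k x
    · exact eq_of_prefix_recursion (F := fun i w => hitWord A x i || φ i w) (h_rec k x) h
  calc S.stateProb t σ
      = poissonProb volume t fun k => {x | S.stateAfter x = σ} := rfl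
    _ = ∑ z with ∀ i, y i = (z i || φ i fun j => y (j.castLE i.isLt.le)),
          poissonProb volume t (fun _ => {x | hitWord A x = z}) := by
        rw [sum_poissonProb_eq volume t fun k => measurable_hitWord hA]
        simp only [h_event, Finset.mem_filter_univ]
    _ = wordProb φ (fun i => Real.exp (-(t * p i))) _ y := by
        rw [← sum_prod_bitProb_eq_wordProb]
        exact Finset.sum_congr rfl fun z _ => by
          rw [poissonProb_hitWord_eq volume t hA hdisj]
          simp only [hp, hA_def]

lemma IsLinearizable.exists_stateProb_eq {S : DartboardSketch C} (hS : S.IsLinearizable) :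
    ∃ (φ : (i : ℕ) → (Fin i → Bool) → Bool) (p : ℕ → ℝ)
      (e : Finset C ≃ (Fin (Fintype.card C) → Bool)),
      (∀ i, Monotone (φ i)) ∧ (∀ i, 0 ≤ p i) ∧ ∀ t σ,
        S.stateProb t σ = wordProb φ (fun i => Real.exp (-(t * p i))) _ (e σ) := by
  obtain ⟨c, φ, hφ, h⟩ := hS
  refine ⟨φ, fun i => if hi : i < Fintype.card C then volume.real (S.cellOf ⁻¹' {c ⟨i, hi⟩}) else 0,
    stateWord c, hφ, fun i => ?_, S.stateProb_eq_wordProb c h fun i => dif_pos i.isLt⟩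
  dsimp only
  split_ifs
  · exact measureReal_nonneg
  · exact le_rfl

end DartboardSketch

section Scale

variable {p : ℝ}

lemma exp_neg_exp_mul (hp : 0 < p) (x : ℝ) :
    Real.exp (-(Real.exp x * p)) = Real.exp (-Real.exp (x + Real.log p)) := by
  rw [Real.exp_add, Real.exp_log hp]

lemma hNat_exp_neg_exp_mul (hp : 0 ≤ p) (x : ℝ) :
    hNat (Real.exp (-(Real.exp x * p))) / Real.log 2 =
      if 0 < p then entropyDensity (x + Real.log p) else 0 := by
  split_ifs with h
  · rw [exp_neg_exp_mul h, entropyDensity]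
  · simp [hp.antisymm' (not_lt.1 h), hNat]

lemma deriv_exp_neg_mul (p t : ℝ) :
    deriv (fun s => Real.exp (-(s * p))) t = -p * Real.exp (-(t * p)) := by
  have h : HasDerivAt (fun s => Real.exp (-(s * p))) (Real.exp (-(t * p)) * -(1 * p)) t :=
    ((hasDerivAt_id t).mul_const p).fun_neg.exp
  rw [h.deriv]
  ring

lemma sq_exp_mul_deriv_exp_neg_mul_sq_div (hp : 0 ≤ p) (x : ℝ) :
    Real.exp x ^ 2 * (deriv (fun s => Real.exp (-(s * p))) (Real.exp x) ^ 2 /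
      (Real.exp (-(Real.exp x * p)) * (1 - Real.exp (-(Real.exp x * p))))) =
      if 0 < p then fisherDensity (x + Real.log p) else 0 := by
  rw [deriv_exp_neg_mul]
  split_ifs with h
  · have h_miss := (sub_pos.2 (exp_neg_exp_lt_one (x + Real.log p))).ne'
    rw [fisherDensity_eq, ← exp_neg_exp_mul h] at *
    rw [Real.exp_add, Real.exp_log h]
    field_simp
  · simp [hp.antisymm' (not_lt.1 h)]

end Scale

namespace DartboardSketch

variable {C : Type*} [Fintype C] {S : DartboardSketch C}

/-- On the logarithmic time axis, the contribution of a cell of size `p` to the entropy and to the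
Fisher information is a translate by `log p` of a fixed density, weighted by the probability that
no earlier cell forces it to be occupied. -/
lemma IsLinearizable.exists_scale_decomposition (hS : S.IsLinearizable) :
    ∃ (s : Finset ℕ) (k : ℕ → ℝ → ℝ) (w : ℕ → ℝ), (∀ i, Antitone (k i)) ∧ (∀ i x, 0 ≤ k i x) ∧
      (∀ x, shannonEntropy (S.stateProb (Real.exp x)) =
        ∑ i ∈ s, k i x * entropyDensity (x + w i)) ∧
      ∀ x, Real.exp x ^ 2 * fisherInformation S.stateProb (Real.exp x) =
        ∑ i ∈ s, k i x * fisherDensity (x + w i) := by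
  obtain ⟨φ, p, e, hφ, hp, h_law⟩ := hS.exists_stateProb_eq
  set q : ℝ → ℕ → ℝ := fun t i => Real.exp (-(t * p i))
  have hq0 : ∀ t, 0 ≤ q t := fun t i => (Real.exp_pos _).le
  have hq1 : ∀ t, 0 ≤ t → q t ≤ 1 := fun t ht i =>
    Real.exp_le_one_iff.2 (neg_nonpos.2 (mul_nonneg ht (hp i)))
  have hq_anti : Antitone q := fun t t' h i =>
    Real.exp_le_exp.2 (neg_le_neg (mul_le_mul_of_nonneg_right h (hp i)))
  have h_stateProb : S.stateProb = fun t σ => wordProb φ (q t) _ (e σ) :=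
    funext fun t => funext (h_law t)
  refine ⟨(Finset.range (Fintype.card C)).filter (0 < p ·),
    fun i x => freeProb φ (q (Real.exp x)) i, fun i => Real.log (p i),
    fun i x y hxy => ?_, fun i x => ?_, fun x => ?_, fun x => ?_⟩
  · exact freeProb_mono hφ (hq0 _) (hq_anti (Real.exp_le_exp.2 hxy)) (hq1 _ (Real.exp_pos x).le) i
  · exact freeProb_nonneg (hq0 _) (hq1 _ (Real.exp_pos x).le) i
  · rw [h_stateProb, shannonEntropy_comp_equiv e, shannonEntropy_wordProb, Finset.sum_filter]
    refine Finset.sum_congr rfl fun i _ => ?_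
    rw [hNat_exp_neg_exp_mul (hp i), mul_ite, mul_zero]
  · rw [h_stateProb, fisherInformation_comp_equiv e (fun t => wordProb φ (q t) _),
      fisherInformation_wordProb φ (p := fun i t => q t i), Finset.mul_sum, Finset.sum_filter]
    · refine Finset.sum_congr rfl fun i _ => ?_
      rw [mul_left_comm, sq_exp_mul_deriv_exp_neg_mul_sq_div (hp i), mul_ite, mul_zero]
    · fun_prop
    · exact fun i h => absurd h (Real.exp_pos _).ne'
    · intro i h
      have h_zero : p i = 0 := by
        simpa only [q, Real.exp_eq_one_iff, neg_eq_zero, mul_eq_zero, Real.exp_ne_zero, false_or]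
          using h
      rw [deriv_exp_neg_mul, h_zero, neg_zero, zero_mul]

lemma IsLinearizable.fisher_le_entropy (hS : S.IsLinearizable) {a b D Hmax Imin : ℝ} (hab : a ≤ b)
    (hD : 40 ≤ D)
    (hH : ∀ t ∈ Icc (Real.exp (a - D)) (Real.exp b), shannonEntropy (S.stateProb t) ≤ Hmax)
    (hI : ∀ t ∈ Icc (Real.exp a) (Real.exp b), Imin ≤ t ^ 2 * fisherInformation S.stateProb t) :
    (1 - 6 * Real.exp (-D / 4)) * (H₀ / I₀) * ((b - a) * Imin) ≤ (b - a + D) * Hmax := by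
  obtain ⟨s, k, w, hk, hk0, h_entropy, h_fisher⟩ := hS.exists_scale_decomposition
  have h_int : ∀ {f : ℝ → ℝ}, Continuous f → ∀ (u v : ℝ) (i : ℕ),
      IntervalIntegrable (fun x => k i x * f (x + w i)) volume u v := fun hf u v i =>
    ((hk i).antitoneOn _).intervalIntegrable.mul_continuousOn (by fun_prop)
  have h_int_sum : ∀ {f : ℝ → ℝ}, Continuous f → ∀ u v : ℝ,
      IntervalIntegrable (fun x => ∑ i ∈ s, k i x * f (x + w i)) volume u v := fun hf u v => by
    simpa only [Finset.sum_fn] using IntervalIntegrable.sum s fun i _ => h_int hf u v i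
  have h_loss : 0 ≤ (1 - 6 * Real.exp (-D / 4)) * (H₀ / I₀) :=
    mul_nonneg (sub_nonneg.2 (six_mul_exp_le_one hD)) H₀_div_I₀_pos.le
  have h_lower : (b - a) * Imin ≤ ∑ i ∈ s, ∫ x in a..b, k i x * fisherDensity (x + w i) := by
    rw [← intervalIntegral.integral_finsetSum fun i _ => h_int continuous_fisherDensity a b i,
      ← smul_eq_mul, ← intervalIntegral.integral_const]
    refine intervalIntegral.integral_mono_on hab (by simp)
      (h_int_sum continuous_fisherDensity a b) fun x hx => ?_
    rw [← h_fisher]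
    exact hI _ ⟨Real.exp_le_exp.2 hx.1, Real.exp_le_exp.2 hx.2⟩
  have h_upper : ∑ i ∈ s, ∫ x in (a - D)..b, k i x * entropyDensity (x + w i) ≤
      (b - (a - D)) * Hmax := by
    rw [← intervalIntegral.integral_finsetSum fun i _ => h_int continuous_entropyDensity _ b i,
      ← smul_eq_mul, ← intervalIntegral.integral_const]
    refine intervalIntegral.integral_mono_on (by linarith)
      (h_int_sum continuous_entropyDensity _ b) (by simp) fun x hx => ?_
    rw [← h_entropy]
    exact hH _ ⟨Real.exp_le_exp.2 hx.1, Real.exp_le_exp.2 hx.2⟩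
  calc (1 - 6 * Real.exp (-D / 4)) * (H₀ / I₀) * ((b - a) * Imin)
      ≤ (1 - 6 * Real.exp (-D / 4)) * (H₀ / I₀) *
          ∑ i ∈ s, ∫ x in a..b, k i x * fisherDensity (x + w i) :=
        mul_le_mul_of_nonneg_left h_lower h_loss
    _ ≤ ∑ i ∈ s, ∫ x in (a - D)..b, k i x * entropyDensity (x + w i) := by
        rw [Finset.mul_sum]
        exact Finset.sum_le_sum fun i _ =>
          integral_mul_fisherDensity_le (hk i) (hk0 i) hab hD (w i)
    _ ≤ (b - a + D) * Hmax := by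
        rwa [sub_add]

end DartboardSketch

lemma exists_scale_gap {d : ℝ} (hd : 0 < d) :
    ∃ D, 40 ≤ D ∧ lossFactor d * (d + D) ≤ (1 - 6 * Real.exp (-D / 4)) * d := by
  rcases le_or_gt (lossFactor d) 0 with h_nonpos | h_pos
  · exact ⟨40, le_rfl, (mul_nonpos_of_nonpos_of_nonneg h_nonpos (by linarith)).trans
      (mul_nonneg (sub_nonneg.2 (six_mul_exp_le_one le_rfl)) hd.le)⟩
  obtain ⟨s, hs, rfl⟩ : ∃ s : ℝ, 0 < s ∧ s ^ 4 = d :=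
    ⟨d ^ (1 / 4 : ℝ), Real.rpow_pos_of_pos hd _, by
      rw [← Real.rpow_natCast, ← Real.rpow_mul hd.le]
      norm_num⟩
  have h_root : (s ^ 4) ^ (-(1 / 4) : ℝ) = s⁻¹ := by
    rw [← Real.rpow_natCast, ← Real.rpow_mul hs.le, ← Real.rpow_neg_one]
    norm_num
  have h_loss : lossFactor (s ^ 4) ≤ 1 - 8 * s⁻¹ := by
    rw [lossFactor, h_root]
    exact sub_le_sub_left (le_max_left _ _) 1
  have hs8 : 8 < s := by
    have h : 8 * s⁻¹ < 1 := by linarith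
    rwa [← div_eq_mul_inv, div_lt_one hs] at h
  have h_cube : 64 * s ≤ s ^ 3 := by nlinarith [mul_pos hs hs]
  have h_exp : 6 * Real.exp (-(4 * s ^ 3) / 4) ≤ s⁻¹ := by
    rw [neg_div, mul_div_cancel_left₀ _ four_ne_zero, Real.exp_neg, ← div_eq_mul_inv,
      div_le_iff₀ (Real.exp_pos _), ← div_eq_inv_mul, le_div_iff₀ hs]
    linarith [Real.add_one_le_exp (s ^ 3)]
  refine ⟨4 * s ^ 3, by linarith, ?_⟩
  calc lossFactor (s ^ 4) * (s ^ 4 + 4 * s ^ 3)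
      ≤ (1 - 8 * s⁻¹) * (s ^ 4 + 4 * s ^ 3) := by gcongr
    _ = (1 - 4 * s⁻¹ - 32 * s⁻¹ ^ 2) * s ^ 4 := by
        field_simp
        ring
    _ ≤ (1 - 6 * Real.exp (-(4 * s ^ 3) / 4)) * s ^ 4 := by
        gcongr ?_ * s ^ 4
        linarith [sq_nonneg s⁻¹, inv_pos.2 hs]

lemma lossFactor_div_lossDenominator_le {d : ℝ} (hd : 0 ≤ d) (hD : 0 < lossDenominator d) :
    lossFactor d / lossDenominator d ≤ lossFactor d := by
  have h_gain : 0 ≤ (344 + 4 * √d) / d * (H₀ / I₀) * lossFactor d ^ 2 :=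
    mul_nonneg (mul_nonneg (by positivity) H₀_div_I₀_pos.le) (sq_nonneg _)
  rw [div_le_iff₀ hD, lossDenominator]
  linarith

lemma tendsto_lossFactor : Tendsto lossFactor atTop (𝓝 1) := by
  have h_pow : Tendsto (fun d : ℝ => 8 * d ^ (-(1 / 4) : ℝ)) atTop (𝓝 (8 * 0)) :=
    (tendsto_rpow_neg_atTop (by norm_num)).const_mul 8
  have h_exp : Tendsto (fun d : ℝ => 5 * Real.exp (-d / 2)) atTop (𝓝 (5 * 0)) :=
    (Real.tendsto_exp_atBot.comp (tendsto_neg_atTop_atBot.atBot_div_const two_pos)).const_mul 5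
  unfold lossFactor
  simpa using (h_pow.max h_exp).const_sub 1

lemma tendsto_lossDenominator : Tendsto lossDenominator atTop (𝓝 1) := by
  have h_coeff : Tendsto (fun d : ℝ => (344 + 4 * √d) / d) atTop (𝓝 (344 * 0 + 4 * 0)) := by
    refine ((tendsto_inv_atTop_zero.const_mul 344).add
      ((tendsto_inv_atTop_zero.comp Real.tendsto_sqrt_atTop).const_mul 4)).congr fun d => ?_
    rw [Function.comp_apply, add_div, mul_div_assoc, Real.sqrt_div_self, div_eq_mul_inv]
  unfold lossDenominator
  simpa using ((h_coeff.mul_const (H₀ / I₀)).mul tendsto_lossFactor).const_add 1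

theorem theorem5p5_general {C : Type*} [Fintype C] {S : DartboardSketch C} (hS : S.IsLinearizable)
    {a b Hmax Imin : ℝ} (hab : a < b) (hImin : 0 < Imin)
    (hH : ∀ t ∈ Ioc 0 (Real.exp b), shannonEntropy (S.stateProb t) ≤ Hmax)
    (hI : ∀ t ∈ Icc (Real.exp a) (Real.exp b), Imin ≤ t ^ 2 * fisherInformation S.stateProb t) :
    H₀ / I₀ * lossFactor (b - a) ≤ Hmax / Imin := by
  obtain ⟨D, hD, h_gap⟩ := exists_scale_gap (sub_pos.2 hab)
  have h_main := hS.fisher_le_entropy hab.le hD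
    (fun t ht => hH t ⟨(Real.exp_pos _).trans_le ht.1, ht.2⟩) hI
  rw [le_div_iff₀ hImin]
  refine le_of_mul_le_mul_left ?_ (show 0 < b - a + D by linarith)
  calc (b - a + D) * (H₀ / I₀ * lossFactor (b - a) * Imin)
      = H₀ / I₀ * Imin * (lossFactor (b - a) * (b - a + D)) := by ring
    _ ≤ H₀ / I₀ * Imin * ((1 - 6 * Real.exp (-D / 4)) * (b - a)) :=
        mul_le_mul_of_nonneg_left h_gap (mul_pos H₀_div_I₀_pos hImin).le
    _ = (1 - 6 * Real.exp (-D / 4)) * (H₀ / I₀) * ((b - a) * Imin) := by ring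
    _ ≤ (b - a + D) * Hmax := h_main

theorem theorem5p5 :
    (∀ {C : Type*} [Fintype C] (S : DartboardSketch C) (_ : S.IsLinearizable)
        (a b Hmax Imin : ℝ) (_ : 1 < b - a) (_ : 0 < Hmax) (_ : 0 < Imin)
        (_ : 0 < lossDenominator (b - a))
        (_ : ∀ t : ℝ, 0 < t → shannonEntropy (S.stateProb t) ≤ Hmax)
        (_ : ∀ t ∈ Set.Icc (Real.exp a) (Real.exp b),
          Imin ≤ t ^ 2 * fisherInformation S.stateProb t),
        H₀ / I₀ * (lossFactor (b - a) / lossDenominator (b - a)) ≤ Hmax / Imin) ∧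
    (∃ ε : ℝ → ℝ, Filter.Tendsto ε Filter.atTop (nhds 0) ∧
      ∀ d : ℝ, 1 < d →
        H₀ / I₀ * (lossFactor d / lossDenominator d) = (1 - ε d) * (H₀ / I₀)) := by
  refine ⟨fun S hS a b Hmax Imin hab _ hImin hD hH hI => ?_,
    fun d => 1 - lossFactor d / lossDenominator d, ?_, fun d _ => by ring⟩
  · exact (mul_le_mul_of_nonneg_left (lossFactor_div_lossDenominator_le (by linarith) hD)
      H₀_div_I₀_pos.le).trans
        (theorem5p5_general hS (by linarith) hImin (fun t ht => hH t ht.1) hI)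
  · simpa using (tendsto_lossFactor.div tendsto_lossDenominator one_ne_zero).const_sub 1
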